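/- Let $X=(X,d)$ be a compact geodesic metric space, and write $B_r(x)=\{y\in X: d(x,y)\le r\}$. Let $\mu$ be an $L$-doubling Borel probability measure on $X$: every ball of positive radius has positive measure, and $\mu(B_{2r}(x))\le L\,\mu(B_r(x))$ for all $x\in X$, $r>0$. Let $\beta=\beta(X)$ be the Besicovitch constant of $X$, i.e. the least $\beta\in\mathbb N$ such that for every $P\subseteq X$ and $\delta>0$ there are $\beta$ countable families of pairwise disjoint closed balls of radius $\delta$ with centres in $P$ whose union covers $P$. For each $n$, let $V$ be a set of $n$ points sampled i.i.d. from $\mu$, let $G^*=(V,E^*)$ be the graph in which two distinct vertices $u,v$ are adjacent iff $d(u,v)\le r$, where $r=r(n)>0$, and let $\widehat G$ be obtained from $G^*$ by inserting each edge not in $G^*$ independently with probability $q=q(n)\in[0,1]$. An edge $(u,v)$ of $\widehat G$ is called bad if $d(x,y)>r$ for every neighbour $x$ of $u$ in $G^*$ and every neighbour $y$ of $v$ in $G^*$. The edge clique number $\omega_{u,v}(\widehat G)$ is the size of the largest clique of $\widehat G$ containing $u$ and $v$. Assumption A: for all sufficiently large $n$ there is a number $s=s(n)\ge \frac{13\ln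 n}{n}$ such that $s\le \mu(B_{r/2}(x))\le \rho s$ for every $x\in X$, where $\rho$ is a constant independent of $n$. Theorem. There are constants $c_1,c_2,c_3>0$, depending only on $L$, $\beta$ and $\rho$, such that the following holds under Assumption A. Let $\kappa=\kappa(n)\to\infty$ as $n\to\infty$, and suppose that for all sufficiently large $n$ $$q\;\le\;\min\left\{c_1,\; c_2\left(\frac1n\right)^{c_3/\kappa}\frac{\kappa}{sn}\right\}.$$ Then, with probability tending to $1$ as $n\to\infty$, every bad edge $(u,v)$ of $\widehat G$ satisfies $\omega_{u,v}(\widehat G)<\kappa$. Moreover, every edge $(u,v)$ of $\widehat G$ with $d(u,v)>3r$ is bad, so the bound applies in particular to all such edges. -/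

import Mathlib

open MeasureTheory Filter Topology
open scoped NNReal ENNReal

/-- A metric space is geodesic if any two points are joined by a path whose length (total
variation) equals their distance. -/
def IsGeodesicSpace (X : Type*) [MetricSpace X] : Prop :=
  ∀ x y : X, ∃ γ : Path x y, eVariationOn γ Set.univ = edist x y

/-- `μ` is an `L`-doubling measure: balls of positive radius have finite positive measure, and
doubling the radius multiplies the measure by at most `L`. -/
structure IsDoublingMeasureWith {X : Type*} [MetricSpace X] [MeasurableSpace X]
    (μ : Measure X) (L : ℝ≥0) : Prop where
  pos : ∀ (x : X) (r : ℝ), 0 < r → 0 < μ (Metric.closedBall x r)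
  finite : ∀ (x : X) (r : ℝ), 0 < r → μ (Metric.closedBall x r) < ∞
  doubling : ∀ (x : X) (r : ℝ), 0 < r →
    μ (Metric.closedBall x (2 * r)) ≤ L * μ (Metric.closedBall x r)

/-- The closed `δ`-balls with centres in `C` form a `δ`-packing with respect to `P`: a countable
collection of pairwise disjoint balls with centres in `P`. -/
def IsPackingCentres {X : Type*} [MetricSpace X] (δ : ℝ) (P C : Set X) : Prop :=
  C ⊆ P ∧ C.Countable ∧ C.PairwiseDisjoint fun x => Metric.closedBall x δ

/-- For every set `P` and every `δ > 0` there are `β` many `δ`-packings with respect to `P` whose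
union covers `P`. -/
def HasBesicovitchCoverings (X : Type*) [MetricSpace X] (β : ℕ) : Prop :=
  ∀ (P : Set X) (δ : ℝ), 0 < δ → ∃ C : Fin β → Set X,
    (∀ i, IsPackingCentres δ P (C i)) ∧ P ⊆ ⋃ i, ⋃ x ∈ C i, Metric.closedBall x δ

/-- The Besicovitch constant `β(X)`: the least number of packings that always suffices.
(It is finite for every metric space that carries a doubling measure.) -/
noncomputable def besicovitchConstant (X : Type*) [MetricSpace X] : ℕ :=
  sInf {β : ℕ | HasBesicovitchCoverings X β}

/-- The density condition (lower bounds) and the regularity condition (upper bounds) on `μ` at the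
scale `r / 2`, for sample size `n`, mass parameter `s` and regularity constant `ρ`. -/
structure AssumptionA {X : Type*} [MetricSpace X] [MeasurableSpace X]
    (μ : Measure X) (ρ : ℝ) (n : ℕ) (r s : ℝ) : Prop where
  le_s : 13 * Real.log n / n ≤ s
  density : ∀ x : X, s ≤ μ.real (Metric.closedBall x (r / 2))
  regularity : ∀ x : X, μ.real (Metric.closedBall x (r / 2)) ≤ ρ * s

/-- The `r`-neighbourhood graph on the points `x i`; the vertices are the labels `i`. -/
def neighborhoodGraph {X V : Type*} [MetricSpace X] (r : ℝ) (x : V → X) : SimpleGraph V where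
  Adj i j := i ≠ j ∧ dist (x i) (x j) ≤ r
  symm := ⟨fun i j h => ⟨h.1.symm, by rw [dist_comm]; exact h.2⟩⟩
  loopless := ⟨fun _ h => h.1 rfl⟩

/-- The graph obtained from `G` by inserting those edges of `H` that are not in `G`. -/
def insertEdges {V : Type*} (G H : SimpleGraph V) : SimpleGraph V :=
  G ⊔ (H \ G)

/-- The law of the randomness of the insertion-only model on `n` vertices: `n` points sampled
i.i.d. from `μ` and, independently of them, one independent coin of bias `q` for every pair of
vertices (recorded as a binomial random graph `H` on `Fin n`). The perturbed graph is
`insertEdges (neighborhoodGraph r x) H`, so that the coin of a pair is used exactly when that pair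
is not an edge of the geometric graph. -/
noncomputable def insertionModel {X : Type*} [MeasurableSpace X] (μ : Measure X) (n : ℕ)
    (q : unitInterval) : Measure ((Fin n → X) × SimpleGraph (Fin n)) :=
  (Measure.pi fun _ : Fin n => μ).prod (SimpleGraph.binomialRandom (Fin n) q)

/-- `(u, v)` is a bad edge of `Ghat` (a perturbation of the `r`-neighbourhood graph `Gstar` on the
points `x i`): every neighbour of `u` in `Gstar` is at distance more than `r` from every neighbour
of `v` in `Gstar`. -/
def IsBadEdge {X V : Type*} [MetricSpace X] (r : ℝ) (x : V → X) (Ghat : SimpleGraph V)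
    (u v : V) : Prop :=
  Ghat.Adj u v ∧ ∀ a ∈ (neighborhoodGraph r x).neighborSet u,
    ∀ b ∈ (neighborhoodGraph r x).neighborSet v, r < dist (x a) (x b)

open Classical in
/-- The edge clique number `ω_{u,v}(G)`: the largest size of a clique of `G` containing `u` and
`v`. -/
noncomputable def edgeCliqueNumber {V : Type*} [Fintype V] (G : SimpleGraph V) (u v : V) : ℕ :=
  (Finset.univ.filter fun S : Finset V => u ∈ S ∧ v ∈ S ∧ G.IsClique (S : Set V)).sup Finset.card

/-! Put m = ⌊κ/5⌋ and let S be a clique of at least 5m vertices through a bad edge (u, v). Badness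
makes every geometric neighbour of u in S an inserted neighbour of v. So either m inserted
neighbours of one vertex crowd into one r-ball, or at least 4m vertices of S lie far from u and are
inserted neighbours of u. Take 4m of these. If no crowding occurs, each is close to fewer than m of
the others, so each has at least 3m inserted neighbours among them (`card_clique_lt_of_isBadEdge`).

Both obstructions concern independent coins and points, so union bounds apply. Crowding has
probability at most n² C(n,m) (Mq)^m, where M = O(s) bounds the mass of an r-ball by doubling. A
dense 4m-set contains 6m² random edges. The hypothesis on q makes each bound at most 1/n. -/

/-! ### Elementary probabilities and edge counting -/

open unitInterval ProbabilityTheory in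
/-- The probability that a binomial random graph contains a given set of edges. -/
lemma SimpleGraph.binomialRandom_real_subset_edgeSet_le {V : Type*} [Finite V] (q : unitInterval)
    (F : Finset (Sym2 V)) :
    (SimpleGraph.binomialRandom V q).real {H | (F : Set (Sym2 V)) ⊆ H.edgeSet} ≤
      (q : ℝ) ^ F.card := by
  have key : SimpleGraph.binomialRandom V q {H | (F : Set (Sym2 V)) ⊆ H.edgeSet} ≤
      (toNNReal q : ℝ≥0∞) ^ F.card := by
    rw [SimpleGraph.binomialRandom_apply']
    calc _ ≤ setBernoulli (Sym2.diagSetᶜ) q {t : Set (Sym2 V) | (F : Set (Sym2 V)) ⊆ t} := by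
          apply measure_mono
          rintro _ ⟨H, hH, rfl⟩
          exact hH
      _ ≤ _ := by
          rw [setBernoulli_apply']
          have : (fun p : Sym2 V → Prop => {i | p i}) ⁻¹' {t | (F : Set (Sym2 V)) ⊆ t} =
              Set.pi F (fun _ => {True}) := by
            ext p
            simp [Set.subset_def, Set.mem_pi]
          rw [this, Measure.infinitePi_pi _ (fun _ _ => MeasurableSet.of_discrete)]
          calc _ ≤ ∏ _e ∈ F, (toNNReal q : ℝ≥0∞) := by
                -- Only an inequality: a diagonal element of `F` is never an edge.
                refine Finset.prod_le_prod' fun e _ => ?_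
                by_cases he : e ∈ (Sym2.diagSetᶜ : Set (Sym2 V)) <;> simp [he]
            _ = _ := by simp
  calc _ ≤ ((toNNReal q : ℝ≥0∞) ^ F.card).toReal := ENNReal.toReal_mono (by simp) key
    _ = _ := by simp

/-- The probability that all points with labels in `T` fall within distance `r` of the point
labelled `x`. -/
lemma measureReal_pi_dist_le {X : Type*} [MetricSpace X] [SecondCountableTopology X]
    [MeasurableSpace X] [BorelSpace X] (μ : Measure X) [IsProbabilityMeasure μ] {r M : ℝ}
    (hM0 : 0 ≤ M) (hM : ∀ a, μ.real (Metric.closedBall a r) ≤ M) {n : ℕ} (x : Fin n)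
    (T : Finset (Fin n)) (hx : x ∉ T) :
    (Measure.pi fun _ : Fin n => μ).real {p | ∀ y ∈ T, dist (p x) (p y) ≤ r} ≤ M ^ T.card := by
  obtain _ | k := n
  · exact x.elim0
  -- Split off coordinate `x` and use Fubini: once that point is fixed at `a`, the others are
  -- independent and each hits the ball around `a` with probability at most `M`.
  set Q : Set (X × (Fin k → X)) := {z | ∀ j, x.succAbove j ∈ T → dist z.1 (z.2 j) ≤ r} with hQ
  have hQm : MeasurableSet Q := by
    have : Q = ⋂ j, ⋂ (_ : x.succAbove j ∈ T), {z | dist z.1 (z.2 j) ≤ r} := by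
      ext; simp [hQ]
    rw [this]
    refine MeasurableSet.iInter fun j => MeasurableSet.iInter fun _ => ?_
    exact measurableSet_le (by fun_prop) measurable_const
  have hpre : {p : Fin (k + 1) → X | ∀ y ∈ T, dist (p x) (p y) ≤ r} =
      (MeasurableEquiv.piFinSuccAbove (fun _ => X) x) ⁻¹' Q := by
    ext p
    simp only [Set.mem_ofPred_eq, Set.mem_preimage, hQ, MeasurableEquiv.piFinSuccAbove_apply,
      Fin.insertNthEquiv_symm_apply, Fin.removeNth]
    constructor
    · exact fun h j hj => h _ hj
    · intro h y hy
      obtain ⟨j, rfl⟩ := Fin.exists_succAbove_eq (x := y) (y := x) (by rintro rfl; exact hx hy)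
      exact h j hy
  have hcard : (Finset.univ.filter fun j => x.succAbove j ∈ T).card = T.card := by
    rw [← Finset.card_map x.succAboveEmb]
    congr 1
    ext y
    simp only [Finset.mem_map, Finset.mem_filter, Finset.mem_univ, true_and]
    constructor
    · rintro ⟨j, hj, rfl⟩; exact hj
    · intro hy
      obtain ⟨j, rfl⟩ := Fin.exists_succAbove_eq (x := y) (y := x) (by rintro rfl; exact hx hy)
      exact ⟨j, hy, rfl⟩
  have key : (Measure.pi fun _ : Fin (k + 1) => μ) {p | ∀ y ∈ T, dist (p x) (p y) ≤ r} ≤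
      ENNReal.ofReal M ^ T.card := by
    rw [hpre, (measurePreserving_piFinSuccAbove (fun _ => μ) x).measure_preimage
      hQm.nullMeasurableSet, Measure.prod_apply hQm]
    calc _ ≤ ∫⁻ _a, ENNReal.ofReal M ^ T.card ∂μ := by
          refine lintegral_mono fun a => ?_
          have : Prod.mk a ⁻¹' Q = Set.univ.pi fun j =>
              if x.succAbove j ∈ T then Metric.closedBall a r else Set.univ := by
            ext p
            simp only [hQ, Set.mem_preimage, Set.mem_ofPred_eq, Set.mem_pi, Set.mem_univ,
              true_imp_iff]
            refine forall_congr' fun j => ?_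
            split_ifs with h <;> simp [h, dist_comm]
          rw [this, Measure.pi_pi, ← hcard, ← Finset.prod_const, Finset.prod_filter]
          refine Finset.prod_le_prod' fun j _ => ?_
          split_ifs
          · rw [← ofReal_measureReal]
            exact ENNReal.ofReal_le_ofReal (hM a)
          · simp
      _ = _ := by simp
  calc _ ≤ (ENNReal.ofReal M ^ T.card).toReal := ENNReal.toReal_mono (by simp) key
    _ = _ := by simp [hM0]

/-- A graph in which every vertex of `R` has at least `d` neighbours in `R` has at least
`|R| d / 2` edges inside `R`. -/
lemma SimpleGraph.exists_edges_of_le_degree {V : Type*} [Fintype V] [DecidableEq V]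
    (H : SimpleGraph V) [DecidableRel H.Adj] (R : Finset V) (d e : ℕ) (he : 2 * e ≤ R.card * d)
    (h : ∀ w ∈ R, d ≤ (R.filter fun y => H.Adj w y).card) :
    ∃ F ∈ R.sym2.powersetCard e, (F : Set (Sym2 V)) ⊆ H.edgeSet := by
  let K : SimpleGraph V :=
    { Adj := fun a b => H.Adj a b ∧ a ∈ R ∧ b ∈ R
      symm := ⟨fun a b h => ⟨h.1.symm, h.2.2, h.2.1⟩⟩
      loopless := ⟨fun a h => h.1.ne rfl⟩ }
  have : DecidableRel K.Adj := fun a b => inferInstanceAs (Decidable (H.Adj a b ∧ a ∈ R ∧ b ∈ R))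
  have hsum := K.sum_degrees_eq_twice_card_edges
  have hle : R.card * d ≤ ∑ w, K.degree w := by
    calc R.card * d = ∑ _w ∈ R, d := by simp
      _ ≤ ∑ w ∈ R, K.degree w := by
          refine Finset.sum_le_sum fun w hw => (h w hw).trans ?_
          rw [← K.card_neighborFinset_eq_degree]
          refine Finset.card_le_card fun y hy => ?_
          rw [Finset.mem_filter] at hy
          rw [SimpleGraph.mem_neighborFinset]
          exact ⟨hy.2, hw, hy.1⟩
      _ ≤ _ := Finset.sum_le_sum_of_subset (Finset.subset_univ _)
  obtain ⟨F, hF, hFc⟩ := Finset.exists_subset_card_eq (s := K.edgeFinset) (n := e) (by omega)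
  refine ⟨F, Finset.mem_powersetCard.2 ⟨fun z hz => ?_, hFc⟩, fun z hz => ?_⟩
  · have := hF hz
    induction z with | _ a b => ?_
    rw [SimpleGraph.mem_edgeFinset, SimpleGraph.mem_edgeSet] at this
    exact Finset.mk_mem_sym2_iff.2 this.2
  · have := hF hz
    induction z with | _ a b => ?_
    rw [SimpleGraph.mem_edgeFinset, SimpleGraph.mem_edgeSet] at this
    exact this.1

/-! ### Large cliques on bad edges force an obstruction -/

/-- Some vertex has `m` neighbours in `H` close to a common vertex. -/
def HasCrowdedNeighbors {X V : Type*} [MetricSpace X] (r : ℝ) (m : ℕ) (p : V → X)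
    (H : SimpleGraph V) : Prop :=
  ∃ (w x : V) (T : Finset V), T.card = m ∧ x ∉ T ∧ ∀ y ∈ T, dist (p x) (p y) ≤ r ∧ H.Adj w y

open Classical in
/-- Some `4 m` vertices induce a subgraph of minimum degree at least `3 m`. -/
def HasDenseSubset {V : Type*} (m : ℕ) (H : SimpleGraph V) : Prop :=
  ∃ R : Finset V, R.card = 4 * m ∧ ∀ w ∈ R, 3 * m ≤ (R.filter fun y => H.Adj w y).card

/-- A common neighbour would be at distance 0 from itself, and if u, v were adjacent they would be
neighbours of each other; both contradict badness. -/
lemma not_adj_of_isBadEdge {X V : Type*} [MetricSpace X] {r : ℝ} {p : V → X} {G : SimpleGraph V}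
    {u v y : V} (h : IsBadEdge r p G u v) (hy : (neighborhoodGraph r p).Adj u y) :
    y ≠ v ∧ ¬ (neighborhoodGraph r p).Adj v y := by
  have hr : 0 ≤ r := dist_nonneg.trans hy.2
  refine ⟨?_, fun hvy => ?_⟩
  · rintro rfl
    have := h.2 y hy u hy.symm
    rw [dist_comm] at this
    exact absurd hy.2 (not_le.2 this)
  · have := h.2 y hy y hvy
    rw [dist_self] at this
    linarith

lemma insertEdges_adj {V : Type*} {G H : SimpleGraph V} {a b : V}
    (h : (insertEdges G H).Adj a b) (hG : ¬ G.Adj a b) : H.Adj a b := by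
  rcases h with h | h
  · exact absurd h hG
  · exact h.1

lemma card_clique_lt_of_isBadEdge {X V : Type*} [MetricSpace X] {r : ℝ} {m : ℕ} (hm : 1 ≤ m)
    {p : V → X} {H : SimpleGraph V} (h1 : ¬ HasCrowdedNeighbors r m p H)
    (h2 : ¬ HasDenseSubset m H) {u v : V}
    (huv : IsBadEdge r p (insertEdges (neighborhoodGraph r p) H) u v) {S : Finset V}
    (hu : u ∈ S) (hv : v ∈ S)
    (hS : (insertEdges (neighborhoodGraph r p) H).IsClique (S : Set V)) : S.card < 5 * m := by
  classical
  have crowd : ∀ (w x : V) (T : Finset V), x ∉ T →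
      (∀ y ∈ T, dist (p x) (p y) ≤ r ∧ H.Adj w y) → T.card < m := by
    intro w x T hx hT
    by_contra! hc
    obtain ⟨T', hT', hc'⟩ := Finset.exists_subset_card_eq hc
    exact h1 ⟨w, x, T', hc', fun h => hx (hT' h), fun y hy => hT y (hT' hy)⟩
  by_contra! hc
  have hA := crowd v u (S.filter fun y => y ≠ u ∧ dist (p u) (p y) ≤ r) (by simp) (by
    intro y hy
    simp only [Finset.mem_filter] at hy
    obtain ⟨hyv, hn⟩ := not_adj_of_isBadEdge huv (y := y) ⟨hy.2.1.symm, hy.2.2⟩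
    exact ⟨hy.2.2, insertEdges_adj (hS hv hy.1 hyv.symm) hn⟩)
  -- 5m vertices, minus u, minus at most m − 1 close ones.
  have hR : 4 * m ≤ (S.filter fun y => y ≠ u ∧ ¬ dist (p u) (p y) ≤ r).card := by
    have e1 := Finset.card_filter_add_card_filter_not (s := S.erase u)
      (fun y => dist (p u) (p y) ≤ r)
    have e2 := Finset.card_erase_of_mem hu
    have e3 : (S.erase u).filter (fun y => dist (p u) (p y) ≤ r) =
        S.filter fun y => y ≠ u ∧ dist (p u) (p y) ≤ r := by ext; simp; tauto
    have e4 : (S.erase u).filter (fun y => ¬ dist (p u) (p y) ≤ r) =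
        S.filter fun y => y ≠ u ∧ ¬ dist (p u) (p y) ≤ r := by ext; simp; tauto
    rw [e3, e4] at e1
    omega
  obtain ⟨R, hRS, hRc⟩ := Finset.exists_subset_card_eq hR
  have hRu : ∀ y ∈ R, H.Adj u y := by
    intro y hy
    have := Finset.mem_filter.1 (hRS hy)
    exact insertEdges_adj (hS hu this.1 this.2.1.symm) fun h => this.2.2 h.2
  refine h2 ⟨R, hRc, fun w hw => ?_⟩
  -- Here u is the hub and w the centre of the crowd, since all of `R` is joined to u by inserted
  -- edges.
  have hT := crowd u w (R.filter fun y => y ≠ w ∧ dist (p w) (p y) ≤ r) (by simp) (by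
    intro y hy
    simp only [Finset.mem_filter] at hy
    exact ⟨hy.2.2, hRu y hy.1⟩)
  have e2 := Finset.card_erase_of_mem hw
  have e5 : (R.erase w).card ≤ (R.filter fun y => y ≠ w ∧ dist (p w) (p y) ≤ r).card +
      (R.filter fun y => H.Adj w y).card := by
    refine (Finset.card_le_card fun y hy => ?_).trans (Finset.card_union_le _ _)
    rw [Finset.mem_erase] at hy
    rw [Finset.mem_union, Finset.mem_filter, Finset.mem_filter]
    by_cases hd : dist (p w) (p y) ≤ r
    · exact Or.inl ⟨hy.2, hy.1, hd⟩
    · have hyS := (Finset.mem_filter.1 (hRS hy.2)).1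
      have hwS := (Finset.mem_filter.1 (hRS hw)).1
      exact Or.inr ⟨hy.2, insertEdges_adj (hS hwS hyS hy.1.symm) fun h => hd h.2⟩
  omega

lemma edgeCliqueNumber_lt {X V : Type*} [MetricSpace X] [Fintype V] {r κ : ℝ} {m : ℕ}
    (hm : 1 ≤ m) (hκ : 5 * (m : ℝ) ≤ κ) {p : V → X} {H : SimpleGraph V}
    (h1 : ¬ HasCrowdedNeighbors r m p H) (h2 : ¬ HasDenseSubset m H) {u v : V}
    (huv : IsBadEdge r p (insertEdges (neighborhoodGraph r p) H) u v) :
    (edgeCliqueNumber (insertEdges (neighborhoodGraph r p) H) u v : ℝ) < κ := by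
  classical
  refine lt_of_lt_of_le ?_ hκ
  have : edgeCliqueNumber (insertEdges (neighborhoodGraph r p) H) u v < 5 * m := by
    rw [edgeCliqueNumber, Finset.sup_lt_iff (by simp; omega)]
    intro S hS
    simp only [Finset.mem_filter, Finset.mem_univ, true_and] at hS
    exact card_clique_lt_of_isBadEdge hm h1 h2 huv hS.1 hS.2.1 hS.2.2
  exact_mod_cast this

/-! ### Union bounds for the two obstructions -/

instance isProbabilityMeasure_insertionModel {X : Type*} [MeasurableSpace X] (μ : Measure X)
    [IsProbabilityMeasure μ] (n : ℕ) (q : unitInterval) :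
    IsProbabilityMeasure (insertionModel μ n q) := by
  unfold insertionModel
  infer_instance

lemma insertionModel_real_hasCrowdedNeighbors_le {X : Type*} [MetricSpace X]
    [SecondCountableTopology X] [MeasurableSpace X] [BorelSpace X] (μ : Measure X)
    [IsProbabilityMeasure μ] {r M : ℝ} (hM0 : 0 ≤ M)
    (hM : ∀ a, μ.real (Metric.closedBall a r) ≤ M) (n m : ℕ) (q : unitInterval) :
    (insertionModel μ n q).real {ω | HasCrowdedNeighbors r m ω.1 ω.2} ≤
      (n : ℝ) ^ 2 * (n.choose m * (M * q) ^ m) := by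
  classical
  let E : Fin n → Fin n → Finset (Fin n) → Set ((Fin n → X) × SimpleGraph (Fin n)) :=
    fun w x T => if x ∈ T then ∅ else {p | ∀ y ∈ T, dist (p x) (p y) ≤ r} ×ˢ
      {H | ((T.image fun y => s(w, y) : Finset (Sym2 (Fin n))) : Set _) ⊆ H.edgeSet}
  have hE : ∀ w x, ∀ T ∈ (Finset.univ : Finset (Fin n)).powersetCard m,
      (insertionModel μ n q).real (E w x T) ≤ (M * q) ^ m := by
    intro w x T hT
    have hc := (Finset.mem_powersetCard.1 hT).2
    by_cases hx : x ∈ T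
    · simp only [E, hx, if_true, measureReal_empty]
      exact pow_nonneg (mul_nonneg hM0 q.2.1) _
    · simp only [E, hx, if_false]
      rw [insertionModel, measureReal_prod_prod, mul_pow]
      refine mul_le_mul ?_ ?_ measureReal_nonneg (pow_nonneg hM0 _)
      · exact hc ▸ measureReal_pi_dist_le μ hM0 hM x T hx
      · refine (SimpleGraph.binomialRandom_real_subset_edgeSet_le q _).trans_eq ?_
        rw [Finset.card_image_of_injective _ (fun a b h => Sym2.congr_right.1 h), hc]
  calc _ ≤ (insertionModel μ n q).real (⋃ w ∈ (Finset.univ : Finset (Fin n)),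
          ⋃ x ∈ (Finset.univ : Finset (Fin n)),
          ⋃ T ∈ (Finset.univ : Finset (Fin n)).powersetCard m, E w x T) := by
        refine measureReal_mono ?_ (measure_ne_top _ _)
        rintro ω ⟨w, x, T, hc, hx, hT⟩
        simp only [Set.mem_iUnion]
        refine ⟨w, Finset.mem_univ _, x, Finset.mem_univ _, T,
          Finset.mem_powersetCard.2 ⟨Finset.subset_univ _, hc⟩, ?_⟩
        simp only [E, hx, if_false]
        refine ⟨fun y hy => (hT y hy).1, ?_⟩
        intro z hz
        obtain ⟨y, hy, rfl⟩ := Finset.mem_image.1 hz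
        exact (hT y hy).2
    _ ≤ ∑ _w : Fin n, ∑ _x : Fin n, ∑ _T ∈ (Finset.univ : Finset (Fin n)).powersetCard m,
          (M * q) ^ m := by
        refine (measureReal_biUnion_finset_le _ _).trans (Finset.sum_le_sum fun w _ => ?_)
        refine (measureReal_biUnion_finset_le _ _).trans (Finset.sum_le_sum fun x _ => ?_)
        exact (measureReal_biUnion_finset_le _ _).trans
          (Finset.sum_le_sum fun T hT => hE w x T hT)
    _ = _ := by
        simp only [Finset.sum_const, Finset.card_powersetCard, Finset.card_univ, Fintype.card_fin,
          nsmul_eq_mul]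
        ring

lemma insertionModel_real_hasDenseSubset_le {X : Type*} [MeasurableSpace X] (μ : Measure X)
    [IsProbabilityMeasure μ] (n : ℕ) {m : ℕ} (hm : 1 ≤ m) (q : unitInterval) :
    (insertionModel μ n q).real {ω | HasDenseSubset m ω.2} ≤
      (n : ℝ) ^ (4 * m) * (2 ^ (10 * m ^ 2) * (q : ℝ) ^ (6 * m ^ 2)) := by
  classical
  have hE : ∀ R : Finset (Fin n), ∀ F ∈ R.sym2.powersetCard (6 * m ^ 2),
      (insertionModel μ n q).real
        (Set.univ ×ˢ {H : SimpleGraph (Fin n) | (F : Set (Sym2 (Fin n))) ⊆ H.edgeSet}) ≤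
        (q : ℝ) ^ (6 * m ^ 2) := by
    intro R F hF
    rw [insertionModel, measureReal_prod_prod, probReal_univ, one_mul]
    exact (SimpleGraph.binomialRandom_real_subset_edgeSet_le q F).trans_eq
      (by rw [(Finset.mem_powersetCard.1 hF).2])
  calc _ ≤ (insertionModel μ n q).real
          (⋃ R ∈ (Finset.univ : Finset (Fin n)).powersetCard (4 * m),
          ⋃ F ∈ R.sym2.powersetCard (6 * m ^ 2), (Set.univ : Set (Fin n → X)) ×ˢ
            {H : SimpleGraph (Fin n) | (F : Set (Sym2 (Fin n))) ⊆ H.edgeSet}) := by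
        refine measureReal_mono ?_ (measure_ne_top _ _)
        rintro ω ⟨R, hc, hR⟩
        obtain ⟨F, hF, hFH⟩ := ω.2.exists_edges_of_le_degree R (3 * m) (6 * m ^ 2)
          (by rw [hc]; nlinarith) (fun w hw => by convert hR w hw)
        simp only [Set.mem_iUnion]
        exact ⟨R, Finset.mem_powersetCard.2 ⟨Finset.subset_univ _, hc⟩, F, hF,
          Set.mem_univ _, hFH⟩
    _ ≤ ∑ R ∈ (Finset.univ : Finset (Fin n)).powersetCard (4 * m),
          ∑ _F ∈ R.sym2.powersetCard (6 * m ^ 2), (q : ℝ) ^ (6 * m ^ 2) := by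
        refine (measureReal_biUnion_finset_le _ _).trans (Finset.sum_le_sum fun R _ => ?_)
        exact (measureReal_biUnion_finset_le _ _).trans (Finset.sum_le_sum fun F hF => hE R F hF)
    _ ≤ ∑ _R ∈ (Finset.univ : Finset (Fin n)).powersetCard (4 * m),
          (2 ^ (10 * m ^ 2) * (q : ℝ) ^ (6 * m ^ 2)) := by
        refine Finset.sum_le_sum fun R hR => ?_
        rw [Finset.sum_const, nsmul_eq_mul]
        refine mul_le_mul_of_nonneg_right ?_ (pow_nonneg q.2.1 _)
        -- `sym2` includes the diagonal, so it has C(4m+1, 2) = 8m² + 2m ≤ 10m² elements.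
        have h1 : (R.sym2.powersetCard (6 * m ^ 2)).card ≤ 2 ^ (10 * m ^ 2) := by
          rw [Finset.card_powersetCard, Finset.card_sym2, (Finset.mem_powersetCard.1 hR).2]
          refine (Nat.choose_le_two_pow _ _).trans (Nat.pow_le_pow_right (by norm_num) ?_)
          rw [Nat.choose_two_right]
          apply Nat.div_le_of_le_mul
          simp only [Nat.add_sub_cancel]
          nlinarith
        exact_mod_cast h1
    _ ≤ _ := by
        rw [Finset.sum_const, nsmul_eq_mul]
        refine mul_le_mul_of_nonneg_right ?_ (mul_nonneg (by positivity) (pow_nonneg q.2.1 _))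
        rw [Finset.card_powersetCard, Finset.card_univ, Fintype.card_fin]
        exact_mod_cast Nat.choose_le_pow n (4 * m)

/-! ### Numerical estimates -/

lemma one_div_rpow_pow_le {n κ : ℝ} (hn : 1 ≤ n) (hκ : 0 < κ) {m : ℕ} (hm : κ ≤ 10 * m) :
    ((1 / n) ^ (30 / κ)) ^ m ≤ (1 / n) ^ 3 := by
  rw [← Real.rpow_natCast _ m, ← Real.rpow_mul (by positivity), ← Real.rpow_natCast _ 3]
  refine Real.rpow_le_rpow_of_exponent_ge (by positivity) ?_ ?_
  · rw [div_le_one (by positivity)]; exact hn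
  · rw [div_mul_eq_mul_div, le_div_iff₀ hκ]
    push_cast
    linarith

lemma crowded_bound {n m : ℕ} {κ a : ℝ} (hn : 1 ≤ n) (hκ : 0 < κ) (hm : κ ≤ 10 * m)
    (ha0 : 0 ≤ a) (ha : a * n ≤ κ * (1 / (n : ℝ)) ^ (30 / κ) / 30) :
    (n : ℝ) ^ 2 * (n.choose m * a ^ m) ≤ 1 / n := by
  have hn' : (1 : ℝ) ≤ n := by exact_mod_cast hn
  set t := (1 / (n : ℝ)) ^ (30 / κ) with ht
  have ht0 : 0 ≤ t := by positivity
  have h1 : (n.choose m : ℝ) * a ^ m ≤ t ^ m := by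
    calc (n.choose m : ℝ) * a ^ m ≤ ((n : ℝ) ^ m / m.factorial) * a ^ m := by
          gcongr
          exact Nat.choose_le_pow_div m n
      _ = (a * n) ^ m / m.factorial := by rw [mul_pow]; ring
      -- κ/30 ≤ m/3; the 3 later absorbs the e from m^m/m! ≤ e^m.
      _ ≤ (m * (t / 3)) ^ m / m.factorial := by
          refine div_le_div_of_nonneg_right (pow_le_pow_left₀ (by positivity) ?_ m) (by positivity)
          refine ha.trans ?_
          nlinarith
      _ = (m : ℝ) ^ m / m.factorial * (t / 3) ^ m := by rw [mul_pow]; ring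
      _ ≤ Real.exp m * (t / 3) ^ m := by
          gcongr
          exact Real.pow_div_factorial_le_exp _ (by positivity) _
      _ = (Real.exp 1 * (t / 3)) ^ m := by rw [mul_pow, ← Real.exp_nat_mul, mul_one]
      _ ≤ t ^ m := by
          gcongr
          have := Real.exp_one_lt_d9
          nlinarith
  calc _ ≤ (n : ℝ) ^ 2 * (1 / n) ^ 3 := by
        gcongr
        exact h1.trans (one_div_rpow_pow_le hn' hκ hm)
    _ = 1 / n := by field_simp

lemma dense_bound {n m : ℕ} {κ q : ℝ} (hn : 1 ≤ n) (hm1 : 1 ≤ m) (hκ : 0 < κ) (hm : κ ≤ 10 * m)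
    (hq0 : 0 ≤ q) (hq : q ≤ 1 / 4 * (1 / (n : ℝ)) ^ (30 / κ)) :
    (n : ℝ) ^ (4 * m) * (2 ^ (10 * m ^ 2) * q ^ (6 * m ^ 2)) ≤ 1 / n := by
  have hn' : (1 : ℝ) ≤ n := by exact_mod_cast hn
  set t := (1 / (n : ℝ)) ^ (30 / κ) with ht
  have ht0 : 0 ≤ t := by positivity
  have htm : t ^ m ≤ (1 / (n : ℝ)) ^ 3 := one_div_rpow_pow_le hn' hκ hm
  have hle : (1 / (n : ℝ)) ≤ 1 := by rw [div_le_one (by positivity)]; exact hn'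
  have h1 : (2 : ℝ) ^ (10 * m ^ 2) * q ^ (6 * m ^ 2) ≤ (1 / (n : ℝ)) ^ (18 * m) := by
    calc (2 : ℝ) ^ (10 * m ^ 2) * q ^ (6 * m ^ 2) ≤
          2 ^ (10 * m ^ 2) * (1 / 4 * t) ^ (6 * m ^ 2) := by gcongr
      -- 2¹⁰ · 4⁻⁶ = 1/4, so the factor 1/4 in `hq` pays for the choice of edges.
      _ = ((2 : ℝ) ^ 10 * (1 / 4) ^ 6) ^ (m ^ 2) * (t ^ m) ^ (6 * m) := by
          rw [mul_pow, mul_pow, ← pow_mul, ← pow_mul, ← pow_mul]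
          ring_nf
      _ ≤ 1 * ((1 / (n : ℝ)) ^ 3) ^ (6 * m) := by
          gcongr
          exact pow_le_one₀ (by norm_num) (by norm_num)
      _ = _ := by rw [one_mul, ← pow_mul]; ring_nf
  calc _ ≤ (n : ℝ) ^ (4 * m) * (1 / (n : ℝ)) ^ (18 * m) := by gcongr
    _ = (1 / (n : ℝ)) ^ (14 * m) := by
        rw [show 18 * m = 4 * m + 14 * m by ring, pow_add, ← mul_assoc, ← mul_pow]
        rw [mul_one_div_cancel (by positivity), one_pow, one_mul]
    _ ≤ (1 / (n : ℝ)) ^ 1 := pow_le_pow_of_le_one (by positivity) hle (by omega)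
    _ = _ := pow_one _

/-- If κ ≤ sn, the second term of the minimum suffices. Otherwise κ ≥ sn ≥ 13 ln n, so n^(−30/κ) ≥
e^(−30/13) ≥ e⁻³ and the first term does. -/
lemma le_quarter_rpow {n : ℕ} {κ s c q : ℝ} (hn : 2 ≤ n) (hκ : 0 < κ) (hs : 13 * Real.log n / n ≤ s)
    (hc0 : 0 ≤ c) (hc : c ≤ 1 / 4)
    (hq : q ≤ min (Real.exp (-3) / 4) (c * (1 / (n : ℝ)) ^ (30 / κ) * (κ / (s * n)))) :
    q ≤ 1 / 4 * (1 / (n : ℝ)) ^ (30 / κ) := by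
  have hn' : (2 : ℝ) ≤ n := by exact_mod_cast hn
  have hlog : 0 < Real.log n := Real.log_pos (by linarith)
  rw [div_le_iff₀ (by positivity)] at hs
  have hsn : 0 < s * n := by linarith
  rcases le_total κ (s * n) with h | h
  · refine hq.trans ((min_le_right _ _).trans ?_)
    calc _ ≤ c * (1 / (n : ℝ)) ^ (30 / κ) * 1 := by
          gcongr
          rw [div_le_one hsn]; exact h
      _ ≤ _ := by rw [mul_one]; gcongr
  · refine hq.trans ((min_le_left _ _).trans ?_)
    have : Real.exp (-3) ≤ (1 / (n : ℝ)) ^ (30 / κ) := by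
      rw [Real.rpow_def_of_pos (by positivity), Real.exp_le_exp, one_div, Real.log_inv,
        neg_mul, neg_le_neg_iff, mul_div_assoc', div_le_iff₀ hκ]
      linarith
    linarith

/-! ### Assembly -/

lemma IsDoublingMeasureWith.real_closedBall_le {X : Type*} [MetricSpace X] [MeasurableSpace X]
    {μ : Measure X} {L : ℝ≥0} (h : IsDoublingMeasureWith μ L) (x : X) {r : ℝ} (hr : 0 < r) :
    μ.real (Metric.closedBall x r) ≤ L * μ.real (Metric.closedBall x (r / 2)) := by
  have h1 := h.doubling x (r / 2) (by positivity)
  rw [mul_div_cancel₀ r two_ne_zero] at h1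
  have := ENNReal.toReal_mono
    (ENNReal.mul_ne_top (by simp) (h.finite x (r / 2) (by positivity)).ne) h1
  simpa [Measure.real] using this

lemma isBadEdge_of_three_mul_lt {X V : Type*} [MetricSpace X] {r : ℝ} {p : V → X}
    {G : SimpleGraph V} {u v : V} (hG : G.Adj u v) (h : 3 * r < dist (p u) (p v)) :
    IsBadEdge r p G u v := by
  refine ⟨hG, fun a ha b hb => ?_⟩
  have h1 : dist (p u) (p a) ≤ r := ha.2
  have h2 : dist (p v) (p b) ≤ r := hb.2
  have h3 := dist_triangle4 (p u) (p a) (p b) (p v)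
  rw [dist_comm (p b)] at h3
  linarith

lemma one_sub_le_insertionModel {X : Type*} [MetricSpace X] [SecondCountableTopology X]
    [MeasurableSpace X] [BorelSpace X] (μ : Measure X) [IsProbabilityMeasure μ] {L : ℝ≥0}
    (hL : IsDoublingMeasureWith μ L) {ρ r s κ : ℝ} {n : ℕ} (q : unitInterval) (hn : 2 ≤ n)
    (hr : 0 < r) (hA : AssumptionA μ ρ n r s) (hκ : 10 ≤ κ)
    (hq : (q : ℝ) ≤ min (Real.exp (-3) / 4)
      (1 / (30 * (1 + L * |ρ|)) * (1 / (n : ℝ)) ^ (30 / κ) * (κ / (s * n)))) :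
    1 - ENNReal.ofReal (2 / n) ≤ insertionModel μ n q
      {ω | ∀ u v : Fin n,
        IsBadEdge r ω.1 (insertEdges (neighborhoodGraph r ω.1) ω.2) u v →
        (edgeCliqueNumber (insertEdges (neighborhoodGraph r ω.1) ω.2) u v : ℝ) < κ} := by
  -- The 1 and the absolute value keep the constant positive for every real ρ and give 1/(30D) ≤
  -- 1/4.
  set D : ℝ := 1 + L * |ρ| with hD
  have hD1 : 1 ≤ D := le_add_of_nonneg_right (by positivity)
  set m := ⌊κ / 5⌋₊ with hm
  have hm5 : 5 * (m : ℝ) ≤ κ := by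
    have := Nat.floor_le (a := κ / 5) (by positivity)
    linarith
  have hm10 : κ ≤ 10 * (m : ℝ) := by
    have := Nat.lt_floor_add_one (κ / 5)
    rw [← hm] at this
    linarith
  have hm1 : 1 ≤ m := Nat.le_floor (by push_cast; linarith)
  have hn' : (2 : ℝ) ≤ n := by exact_mod_cast hn
  have hs : 0 < s := by
    have := hA.le_s
    have hlog : 0 < Real.log n := Real.log_pos (by linarith)
    exact lt_of_lt_of_le (by positivity) this
  have hM : ∀ a, μ.real (Metric.closedBall a r) ≤ D * s := fun a => by
    calc _ ≤ L * (ρ * s) := (hL.real_closedBall_le a hr).trans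
          (mul_le_mul_of_nonneg_left (hA.regularity a) L.2)
      _ ≤ L * (|ρ| * s) := by gcongr; exact le_abs_self ρ
      _ ≤ D * s := by rw [hD]; nlinarith
  have h1 := (insertionModel_real_hasCrowdedNeighbors_le μ (by positivity) hM n m q).trans
    (crowded_bound (κ := κ) (by omega) (by linarith) hm10
      (mul_nonneg (by positivity) q.2.1) (by
        calc D * s * (q : ℝ) * n ≤ D * s *
              (1 / (30 * D) * (1 / (n : ℝ)) ^ (30 / κ) * (κ / (s * n))) * n := by
              gcongr
              exact hq.trans (min_le_right _ _)
          _ = κ * (1 / (n : ℝ)) ^ (30 / κ) / 30 := by field_simp))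
  have h2 := (insertionModel_real_hasDenseSubset_le μ n hm1 q).trans
    (dense_bound (κ := κ) (by omega) hm1 (by linarith) hm10 q.2.1
      (le_quarter_rpow hn (by linarith) hA.le_s (by positivity)
        (by rw [div_le_div_iff₀ (by positivity) (by norm_num)]; linarith) hq))
  set good := {ω : (Fin n → X) × SimpleGraph (Fin n) | ∀ u v : Fin n,
        IsBadEdge r ω.1 (insertEdges (neighborhoodGraph r ω.1) ω.2) u v →
        (edgeCliqueNumber (insertEdges (neighborhoodGraph r ω.1) ω.2) u v : ℝ) < κ} with hgood
  have hsub : goodᶜ ⊆ {ω | HasCrowdedNeighbors r m ω.1 ω.2} ∪ {ω | HasDenseSubset m ω.2} := by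
    intro ω hω
    by_contra hc
    rw [Set.mem_union, not_or] at hc
    exact hω fun u v huv => edgeCliqueNumber_lt hm1 hm5 hc.1 hc.2 huv
  have hbad : insertionModel μ n q goodᶜ ≤ ENNReal.ofReal (2 / n) := by
    rw [← ofReal_measureReal]
    refine ENNReal.ofReal_le_ofReal ?_
    calc _ ≤ _ := (measureReal_mono hsub).trans (measureReal_union_le _ _)
      _ ≤ 1 / (n : ℝ) + 1 / n := add_le_add h1 h2
      _ = 2 / n := by ring
  rw [tsub_le_iff_right]
  calc (1 : ℝ≥0∞) = insertionModel μ n q (good ∪ goodᶜ) := by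
        rw [Set.union_compl_self, measure_univ]
    _ ≤ insertionModel μ n q good + insertionModel μ n q goodᶜ := measure_union_le _ _
    _ ≤ _ := by gcongr

theorem mainTheorem2 (L : ℝ≥0) (β : ℕ) (ρ : ℝ) :
    ∃ c₁ c₂ c₃ : ℝ, 0 < c₁ ∧ 0 < c₂ ∧ 0 < c₃ ∧
      ∀ (X : Type*) [MetricSpace X] [CompactSpace X] [MeasurableSpace X] [BorelSpace X]
        (μ : Measure X) [IsProbabilityMeasure μ],
        IsGeodesicSpace X → IsDoublingMeasureWith μ L → besicovitchConstant X = β →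
        ∀ (r s κ : ℕ → ℝ) (q : ℕ → unitInterval),
          (∀ᶠ n in atTop, 0 < r n ∧ AssumptionA μ ρ n (r n) (s n)) →
          Tendsto κ atTop atTop →
          (∀ᶠ n in atTop, (q n : ℝ) ≤
            min c₁ (c₂ * (1 / (n : ℝ)) ^ (c₃ / κ n) * (κ n / (s n * n)))) →
          Tendsto (fun n => insertionModel μ n (q n)
            {ω | ∀ u v : Fin n,
              IsBadEdge (r n) ω.1 (insertEdges (neighborhoodGraph (r n) ω.1) ω.2) u v →
              (edgeCliqueNumber (insertEdges (neighborhoodGraph (r n) ω.1) ω.2) u v : ℝ) < κ n})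
            atTop (𝓝 1) ∧
          ∀ (n : ℕ) (ω : (Fin n → X) × SimpleGraph (Fin n)) (u v : Fin n),
            (insertEdges (neighborhoodGraph (r n) ω.1) ω.2).Adj u v →
            3 * r n < dist (ω.1 u) (ω.1 v) →
            IsBadEdge (r n) ω.1 (insertEdges (neighborhoodGraph (r n) ω.1) ω.2) u v := by
  refine ⟨Real.exp (-3) / 4, 1 / (30 * (1 + L * |ρ|)), 30, by positivity, by positivity,
    by norm_num, ?_⟩
  intro X _ _ _ _ μ _ _ hL _ r s κ q hA hκ hq
  refine ⟨?_, fun n ω u v => isBadEdge_of_three_mul_lt⟩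
  have hlim : Tendsto (fun n : ℕ => 1 - ENNReal.ofReal (2 / n)) atTop (𝓝 1) := by
    have := ENNReal.tendsto_ofReal (tendsto_const_div_atTop_nhds_zero_nat (2 : ℝ))
    rw [ENNReal.ofReal_zero] at this
    simpa using ENNReal.Tendsto.sub (tendsto_const_nhds (x := (1 : ℝ≥0∞))) this (by simp)
  refine tendsto_of_tendsto_of_tendsto_of_le_of_le' hlim tendsto_const_nhds ?_
    (Eventually.of_forall fun n => prob_le_one)
  filter_upwards [hA, hκ.eventually_ge_atTop 10, hq, eventually_ge_atTop 2] with n hAn hκn hqn hn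
  exact one_sub_le_insertionModel μ hL (q n) hn hAn.1 hAn.2 hκn hqn
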